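/- **Conventions.** All C*-algebras are complex, unital and nonzero. For a C*-algebra $\mathfrak{A}$, let $\mathfrak{sa}(\mathfrak{A})$ be its self-adjoint part and $\mathscr{S}(\mathfrak{A})$ its state space. A seminorm $\mathsf{L}$ defined on a subspace $\mathrm{dom}(\mathsf{L})$ of $\mathfrak{sa}(\mathfrak{A})$ is extended to $\mathfrak{sa}(\mathfrak{A})$ by $\mathsf{L}(a)=\infty$ for $a\notin\mathrm{dom}(\mathsf{L})$. A *Leibniz quantum compact metric space* $(\mathfrak{A},\mathsf{L})$ is a unital C*-algebra $\mathfrak{A}$ with a seminorm $\mathsf{L}$ defined on a dense Jordan-Lie subalgebra $\mathrm{dom}(\mathsf{L})$ of $\mathfrak{sa}(\mathfrak{A})$ such that: 1. $\{a\in\mathrm{dom}(\mathsf{L}) : \mathsf{L}(a)=0\}=\mathbb{R}1_{\mathfrak{A}}$; 2. the Monge-Kantorovich metric $\mathsf{mk}_{\mathsf{L}}(\varphi,\psi)=\sup\{|\varphi(a)-\psi(a)| : a\in\mathrm{dom}(\mathsf{L}),\ \mathsf{L}(a)\leq 1\}$ metrizes the weak* topology on $\mathscr{S}(\mathfrak{A})$;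 3. for all $a,b\in\mathrm{dom}(\mathsf{L})$, both $\mathsf{L}\left(\frac{ab+ba}{2}\right)$ and $\mathsf{L}\left(\frac{ab-ba}{2i}\right)$ are at most $\|a\|\,\mathsf{L}(b)+\|b\|\,\mathsf{L}(a)$; 4. $\mathsf{L}$ is lower semi-continuous for the norm of $\mathfrak{A}$. A *tunnel* $\tau=(\mathfrak{D},\mathsf{L}_{\mathfrak{D}},\pi,\rho)$ from $(\mathfrak{A},\mathsf{L}_{\mathfrak{A}})$ to $(\mathfrak{B},\mathsf{L}_{\mathfrak{B}})$ is a Leibniz quantum compact metric space $(\mathfrak{D},\mathsf{L}_{\mathfrak{D}})$ with surjective $*$-homomorphisms $\pi:\mathfrak{D}\to\mathfrak{A}$ and $\rho:\mathfrak{D}\to\mathfrak{B}$ such that $\mathsf{L}_{\mathfrak{A}}(a)=\inf\{\mathsf{L}_{\mathfrak{D}}(d) : d\in\mathfrak{sa}(\mathfrak{D}),\ \pi(d)=a\}$ for all $a\in\mathfrak{sa}(\mathfrak{A})$ and $\mathsf{L}_{\mathfrak{B}}(b)=\inf\{\mathsf{L}_{\mathfrak{D}}(d) : d\in\mathfrak{sa}(\mathfrak{D}),\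 \rho(d)=b\}$ for all $b\in\mathfrak{sa}(\mathfrak{B})$. Its *extent* is the nonnegative real number $$\mathrm{extent}(\tau)=\max\left\{\mathrm{Haus}(\mathscr{S}(\mathfrak{D}),\{\varphi\circ\pi : \varphi\in\mathscr{S}(\mathfrak{A})\}),\ \mathrm{Haus}(\mathscr{S}(\mathfrak{D}),\{\varphi\circ\rho : \varphi\in\mathscr{S}(\mathfrak{B})\})\right\},$$ where $\mathrm{Haus}$ is the Hausdorff distance for $\mathsf{mk}_{\mathsf{L}_{\mathfrak{D}}}$. **Theorem.** Let $(\mathfrak{A},\mathsf{L}_{\mathfrak{A}})$, $(\mathfrak{B},\mathsf{L}_{\mathfrak{B}})$ and $(\mathfrak{E},\mathsf{L}_{\mathfrak{E}})$ be Leibniz quantum compact metric spaces, let $\tau_1=(\mathfrak{D}_1,\mathsf{L}_1,\pi_1,\pi_2)$ be a tunnel from $(\mathfrak{A},\mathsf{L}_{\mathfrak{A}})$ to $(\mathfrak{B},\mathsf{L}_{\mathfrak{B}})$, let $\tau_2=(\mathfrak{D}_2,\mathsf{L}_2,\rho_1,\rho_2)$ be a tunnel from $(\mathfrak{B},\mathsf{L}_{\mathfrak{B}})$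 to $(\mathfrak{E},\mathsf{L}_{\mathfrak{E}})$, and let $\varepsilon>0$. For $(d_1,d_2)\in\mathfrak{sa}(\mathfrak{D}_1\oplus\mathfrak{D}_2)$ set $$\mathsf{L}(d_1,d_2)=\max\left\{\mathsf{L}_1(d_1),\ \mathsf{L}_2(d_2),\ \tfrac{1}{\varepsilon}\|\pi_2(d_1)-\rho_1(d_2)\|_{\mathfrak{B}}\right\},$$ and let $\eta_1:(d_1,d_2)\mapsto d_1$ and $\eta_2:(d_1,d_2)\mapsto d_2$. Then $(\mathfrak{D}_1\oplus\mathfrak{D}_2,\mathsf{L})$ is a Leibniz quantum compact metric space, and $\tau_3=(\mathfrak{D}_1\oplus\mathfrak{D}_2,\mathsf{L},\pi_1\circ\eta_1,\rho_2\circ\eta_2)$ is a tunnel from $(\mathfrak{A},\mathsf{L}_{\mathfrak{A}})$ to $(\mathfrak{E},\mathsf{L}_{\mathfrak{E}})$. All three extents are finite, and $$\mathrm{extent}(\tau_3)\leq\mathrm{extent}(\tau_1)+\mathrm{extent}(\tau_2)+\varepsilon.$$ Moreover, for $j\in\{1,2\}$, the map $\varphi\mapsto\varphi\circ\eta_j$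 is affine and is an isometry from $(\mathscr{S}(\mathfrak{D}_j),\mathsf{mk}_{\mathsf{L}_j})$ into $(\mathscr{S}(\mathfrak{D}_1\oplus\mathfrak{D}_2),\mathsf{mk}_{\mathsf{L}})$. -/

import Mathlib

open scoped ENNReal NNReal ComplexOrder

namespace QuantumMetric

section StateSpace

variable {A B : Type*} [CStarAlgebra A] [CStarAlgebra B]

/-- The state space of a unital C*-algebra: the positive linear functionals with value `1` at `1`.
As a subset of `WeakDual ℂ A`, it carries the weak* topology. -/
def stateSpace (A : Type*) [CStarAlgebra A] : Set (WeakDual ℂ A) :=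
  {φ | φ 1 = 1 ∧ ∀ a : A, 0 ≤ φ (star a * a)}

/-- The transpose `φ ↦ φ ∘ f`, from the states of `B` to the states of `A`, of a unital
`*`-homomorphism `f : A → B`. -/
noncomputable def dualMap (f : A →⋆ₐ[ℂ] B) (φ : stateSpace B) : stateSpace A :=
  ⟨StrongDual.toWeakDual
      ((WeakDual.toStrongDual (φ : WeakDual ℂ B)).comp
        ⟨(f : A →ₗ[ℂ] B), AddMonoidHomClass.continuous_of_bound f 1 fun a => by
          simpa using NonUnitalStarAlgHom.norm_apply_le f a⟩), by
    refine ⟨?_, fun a => ?_⟩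
    · change (φ : WeakDual ℂ B) (f 1) = 1
      rw [map_one]
      exact φ.2.1
    · change 0 ≤ (φ : WeakDual ℂ B) (f (star a * a))
      rw [map_mul, map_star]
      exact φ.2.2 (f a)⟩

theorem dualMap_apply (f : A →⋆ₐ[ℂ] B) (φ : stateSpace B) (a : A) :
    (dualMap f φ : WeakDual ℂ A) a = (φ : WeakDual ℂ B) (f a) := rfl

/-- A map between state spaces is affine if it preserves convex combinations. -/
def IsAffineMap (F : stateSpace B → stateSpace A) : Prop :=
  ∀ t : ℝ, 0 ≤ t → t ≤ 1 → ∀ φ ψ χ : stateSpace B,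
    (χ : WeakDual ℂ B) = (t : ℂ) • (φ : WeakDual ℂ B) + ((1 - t : ℝ) : ℂ) • (ψ : WeakDual ℂ B) →
    (F χ : WeakDual ℂ A) =
      (t : ℂ) • (F φ : WeakDual ℂ A) + ((1 - t : ℝ) : ℂ) • (F ψ : WeakDual ℂ A)

end StateSpace

section SelfAdjoint

variable {A B : Type*} [CStarAlgebra A] [CStarAlgebra B]

/-- The restriction of a `*`-homomorphism to the self-adjoint parts. -/
def saMap (f : A →⋆ₐ[ℂ] B) (a : selfAdjoint A) : selfAdjoint B :=
  ⟨f a, by rw [selfAdjoint.mem_iff, ← map_star, selfAdjoint.mem_iff.mp a.2]⟩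

/-- The Jordan product `(ab + ba) / 2`. -/
noncomputable def jordan (a b : selfAdjoint A) : selfAdjoint A :=
  ⟨(2 : ℂ)⁻¹ • ((a : A) * b + b * a), by
    rw [selfAdjoint.mem_iff, star_smul, star_add, star_mul, star_mul,
      selfAdjoint.mem_iff.mp a.2, selfAdjoint.mem_iff.mp b.2, add_comm]
    simp⟩

/-- The Lie product `(ab - ba) / (2i)`. -/
noncomputable def lie (a b : selfAdjoint A) : selfAdjoint A :=
  ⟨(2 * Complex.I)⁻¹ • ((a : A) * b - b * a), by
    rw [selfAdjoint.mem_iff, star_smul, star_sub, star_mul, star_mul,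
      selfAdjoint.mem_iff.mp a.2, selfAdjoint.mem_iff.mp b.2, ← neg_sub ((a : A) * b) (b * a),
      smul_neg, ← neg_smul]
    simp⟩

end SelfAdjoint

section Metric

variable {A : Type*} [CStarAlgebra A]

/-- The Monge-Kantorovich distance
`sup {|φ a - ψ a| : a self-adjoint, L a ≤ 1}` of two states, with values in `[0, ∞]`.
A seminorm `L` with a domain in the self-adjoint part is encoded throughout by its extension by `∞`
outside of its domain. -/
noncomputable def mkDist (L : selfAdjoint A → ℝ≥0∞) (φ ψ : stateSpace A) : ℝ≥0∞ :=
  ⨆ (a : selfAdjoint A) (_ : L a ≤ 1), edist ((φ : WeakDual ℂ A) a) ((ψ : WeakDual ℂ A) a)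

/-- The Monge-Kantorovich distance as an extended pseudometric structure on the state space. -/
noncomputable abbrev mkSpace (L : selfAdjoint A → ℝ≥0∞) : PseudoEMetricSpace (stateSpace A) where
  edist := mkDist L
  edist_self φ := by simp [mkDist]
  edist_comm φ ψ := by simp only [mkDist, edist_comm]
  edist_triangle φ ψ χ := by
    refine iSup₂_le fun a ha => (edist_triangle _ ((ψ : WeakDual ℂ A) a) _).trans ?_
    exact add_le_add
      (le_iSup₂ (f := fun (a : selfAdjoint A) (_ : L a ≤ 1) =>
        edist ((φ : WeakDual ℂ A) a) ((ψ : WeakDual ℂ A) a)) a ha)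
      (le_iSup₂ (f := fun (a : selfAdjoint A) (_ : L a ≤ 1) =>
        edist ((ψ : WeakDual ℂ A) a) ((χ : WeakDual ℂ A) a)) a ha)

/-- The Hausdorff distance of two sets of states for the Monge-Kantorovich distance of `L`. -/
noncomputable def mkHausdorff (L : selfAdjoint A → ℝ≥0∞) (S T : Set (stateSpace A)) : ℝ≥0∞ :=
  @Metric.hausdorffEDist (stateSpace A) (mkSpace L) S T

/-- `(A, L)` is a Leibniz quantum compact metric space. Here `L` is the extension by `∞` of a
seminorm whose domain is `{a | L a < ∞}`; this is a real subspace of the self-adjoint part by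
`add_le` and `smul_eq`, and it is closed under both products by the Leibniz inequalities. -/
structure IsLeibnizQCMS (A : Type*) [CStarAlgebra A] (L : selfAdjoint A → ℝ≥0∞) : Prop where
  nontrivial : Nontrivial A
  add_le : ∀ a b, L (a + b) ≤ L a + L b
  smul_eq : ∀ (r : ℝ) (a : selfAdjoint A), L (r • a) = ‖r‖ₑ * L a
  dense_domain : Dense {a : selfAdjoint A | L a < ∞}
  eq_zero_iff : ∀ a, L a = 0 ↔ ∃ r : ℝ, a = r • (1 : selfAdjoint A)
  /-- The Monge-Kantorovich distance is finite. -/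
  mkDist_ne_top : ∀ φ ψ : stateSpace A, mkDist L φ ψ ≠ ∞
  /-- The Monge-Kantorovich distance induces the weak* topology on the state space (so, that
  topology being Hausdorff, it separates the states and is a metric). -/
  metrizes : (mkSpace L).toUniformSpace.toTopologicalSpace =
    (instTopologicalSpaceSubtype : TopologicalSpace (stateSpace A))
  leibniz_jordan : ∀ a b, L a < ∞ → L b < ∞ → L (jordan a b) ≤ ‖(a : A)‖ₑ * L b + ‖(b : A)‖ₑ * L a
  leibniz_lie : ∀ a b, L a < ∞ → L b < ∞ → L (lie a b) ≤ ‖(a : A)‖ₑ * L b + ‖(b : A)‖ₑ * L a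
  lowerSemicontinuous : LowerSemicontinuous L

end Metric

section Tunnel

variable {A B D : Type*} [CStarAlgebra A] [CStarAlgebra B] [CStarAlgebra D]

/-- `(D, LD, π, ρ)` is a tunnel from `(A, LA)` to `(B, LB)`. -/
structure IsTunnel (LA : selfAdjoint A → ℝ≥0∞) (LB : selfAdjoint B → ℝ≥0∞)
    (LD : selfAdjoint D → ℝ≥0∞) (π : D →⋆ₐ[ℂ] A) (ρ : D →⋆ₐ[ℂ] B) : Prop where
  isLeibnizQCMS : IsLeibnizQCMS D LD
  surjective_left : Function.Surjective π
  surjective_right : Function.Surjective ρ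
  quotient_left : ∀ a, LA a = ⨅ (d : selfAdjoint D) (_ : saMap π d = a), LD d
  quotient_right : ∀ b, LB b = ⨅ (d : selfAdjoint D) (_ : saMap ρ d = b), LD d

/-- The extent of a tunnel `(D, LD, π, ρ)`, with values in `[0, ∞]`. -/
noncomputable def extent (LD : selfAdjoint D → ℝ≥0∞) (π : D →⋆ₐ[ℂ] A) (ρ : D →⋆ₐ[ℂ] B) : ℝ≥0∞ :=
  max (mkHausdorff LD Set.univ (Set.range (dualMap π)))
    (mkHausdorff LD Set.univ (Set.range (dualMap ρ)))

end Tunnel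

section Composition

variable {B D₁ D₂ : Type*} [CStarAlgebra B] [CStarAlgebra D₁] [CStarAlgebra D₂]

/-- The coordinate projection `D₁ ⊕ D₂ → D₁`. The direct sum is the product algebra `D₁ × D₂`,
with the coordinatewise operations and the maximum norm. -/
noncomputable abbrev projFst (D₁ D₂ : Type*) [CStarAlgebra D₁] [CStarAlgebra D₂] :
    (D₁ × D₂) →⋆ₐ[ℂ] D₁ :=
  StarAlgHom.fst ℂ D₁ D₂

/-- The coordinate projection `D₁ ⊕ D₂ → D₂`. -/
noncomputable abbrev projSnd (D₁ D₂ : Type*) [CStarAlgebra D₁] [CStarAlgebra D₂] :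
    (D₁ × D₂) →⋆ₐ[ℂ] D₂ :=
  StarAlgHom.snd ℂ D₁ D₂

/-- The seminorm `max {L₁ d₁, L₂ d₂, ‖π₂ d₁ - ρ₁ d₂‖ / ε}` on the self-adjoint part
of `D₁ ⊕ D₂`. -/
noncomputable def composedSeminorm (L₁ : selfAdjoint D₁ → ℝ≥0∞) (L₂ : selfAdjoint D₂ → ℝ≥0∞)
    (π₂ : D₁ →⋆ₐ[ℂ] B) (ρ₁ : D₂ →⋆ₐ[ℂ] B) (ε : ℝ) (d : selfAdjoint (D₁ × D₂)) : ℝ≥0∞ :=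
  max (max (L₁ (saMap (projFst D₁ D₂) d)) (L₂ (saMap (projSnd D₁ D₂) d)))
    (ENNReal.ofReal (1 / ε * ‖π₂ (d : D₁ × D₂).1 - ρ₁ (d : D₁ × D₂).2‖))

end Composition

end QuantumMetric

/-! Both `L₁` and `L₂` induce the same quotient seminorm on `B`. So an element of either summand
lifts to a pair whose coordinates agree in `B`, at the cost of an arbitrarily small increase of the
seminorm; on such pairs the `ε` term vanishes (`composedSeminorm_saPair`). The coordinate
projections are therefore quantum isometries, which gives the quotient conditions (`eq_iInf_comp`)
and the isometries of state spaces (`mkDist_dualMap_eq`).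

For the topology, a state `μ` of `B` is used to retract states of the sum onto each summand. The
distance in the sum is bounded by the two distances of retracts plus `ε` times the change of the
weight `χ (1, 0)` (`mkDist_composedSeminorm_le`), and this bound is weak* continuous.

For the extent, a state of the sum is a mixture of `φ₁` on `D₁` and `φ₂` on `D₂`. Move `φ₂` near
some `μ ∘ ρ₁`, cross to `μ ∘ π₂` at cost `ε`, then move the resulting state of `D₁` near the states
of `A` (`mkHausdorff_comp_le`). -/

open Filter Topology

namespace QuantumMetric

/-! ### States: positivity, existence, weak* compactness -/

section States

variable {A B : Type*} [CStarAlgebra A] [CStarAlgebra B]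

theorem apply_nonneg_of_nonneg {f : A →ₗ[ℂ] ℂ} (hf : ∀ a, 0 ≤ f (star a * a))
    [PartialOrder A] [StarOrderedRing A] {a : A} (ha : 0 ≤ a) : 0 ≤ f a := by
  obtain ⟨b, rfl⟩ := CStarAlgebra.nonneg_iff_eq_star_mul_self.mp ha
  exact hf b

/-- A positive functional is bounded by its value at `1` on self-adjoint elements. -/
theorem norm_apply_le_of_isSelfAdjoint {f : A →ₗ[ℂ] ℂ} (hf : ∀ a, 0 ≤ f (star a * a))
    {a : A} (ha : IsSelfAdjoint a) : ‖f a‖ ≤ ‖a‖ * ‖f 1‖ := by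
  let _ : PartialOrder A := CStarAlgebra.spectralOrder A
  have : StarOrderedRing A := CStarAlgebra.spectralOrderedRing A
  have h1 : 0 ≤ f 1 := by simpa using hf 1
  have hM : f (algebraMap ℝ A ‖a‖) = (‖a‖ : ℂ) * f 1 := by
    rw [Algebra.algebraMap_eq_smul_one, ← Complex.coe_smul, map_smul, smul_eq_mul]
  have hu : 0 ≤ f (algebraMap ℝ A ‖a‖ - a) :=
    apply_nonneg_of_nonneg hf (sub_nonneg.mpr ha.le_algebraMap_norm_self)
  have hl : 0 ≤ f (algebraMap ℝ A ‖a‖ + a) :=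
    apply_nonneg_of_nonneg hf (by
      simpa [neg_le_iff_add_nonneg, add_comm] using ha.neg_algebraMap_norm_le_self)
  rw [map_sub, hM] at hu
  rw [map_add, hM] at hl
  rw [Complex.le_def] at h1 hu hl
  simp only [Complex.zero_re, Complex.zero_im, Complex.sub_re, Complex.sub_im, Complex.add_re,
    Complex.add_im, Complex.re_ofReal_mul, Complex.im_ofReal_mul] at h1 hu hl
  have e1 : f 1 = ((f 1).re : ℂ) := Complex.ext rfl (by simp [← h1.2])
  have ea : f a = ((f a).re : ℂ) := Complex.ext rfl (by
    have := hu.2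
    rw [← h1.2] at this
    simp; linarith)
  rw [e1, ea, Complex.norm_real, Complex.norm_real, Real.norm_eq_abs, Real.norm_eq_abs,
    abs_of_nonneg h1.1, abs_le]
  constructor <;> linarith [hu.1, hl.1]

/-- The factor 2 comes from splitting into real and imaginary parts; boundedness is all that is
needed. -/
theorem norm_apply_le {f : A →ₗ[ℂ] ℂ} (hf : ∀ a, 0 ≤ f (star a * a)) (a : A) :
    ‖f a‖ ≤ 2 * ‖a‖ * ‖f 1‖ := by
  have h := realPart_add_I_smul_imaginaryPart a
  calc ‖f a‖ = ‖f (realPart a : A) + Complex.I * f (imaginaryPart a : A)‖ := by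
        conv_lhs => rw [← h]
        simp
    _ ≤ ‖f (realPart a : A)‖ + ‖f (imaginaryPart a : A)‖ := by
        refine (norm_add_le _ _).trans ?_
        simp
    _ ≤ ‖(realPart a : A)‖ * ‖f 1‖ + ‖(imaginaryPart a : A)‖ * ‖f 1‖ :=
        add_le_add (norm_apply_le_of_isSelfAdjoint hf (realPart a).2)
          (norm_apply_le_of_isSelfAdjoint hf (imaginaryPart a).2)
    _ ≤ ‖a‖ * ‖f 1‖ + ‖a‖ * ‖f 1‖ := by
        gcongr
        · exact realPart.norm_le a
        · exact imaginaryPart.norm_le a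
    _ = 2 * ‖a‖ * ‖f 1‖ := by ring

/-- A functional which is contractive and sends `1` to `1` is positive. -/
theorem apply_nonneg_of_norm_le {f : A →ₗ[ℂ] ℂ} (hf : ∀ a, ‖f a‖ ≤ ‖a‖) (h1 : f 1 = 1) (a : A) :
    0 ≤ f (star a * a) := by
  let _ : PartialOrder A := CStarAlgebra.spectralOrder A
  have : StarOrderedRing A := CStarAlgebra.spectralOrderedRing A
  have : Nontrivial A := ⟨1, 0, fun h => by simp [h] at h1⟩
  set x := star a * a with hx
  have hsa : star x = x := IsSelfAdjoint.star_mul_self a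
  have hx0 : 0 ≤ x := star_mul_self_nonneg a
  have him : (f x).im = 0 := by
    -- Compare `|f (x + ir)|²` with `‖x + ir‖² ≤ ‖x‖² + r²`: the `r²` cancel, and a term linear in
    -- `r` stays bounded only if its coefficient vanishes.
    have key : ∀ r : ℝ, 2 * r * (f x).im ≤ ‖x‖ ^ 2 := by
      intro r
      have e : ‖x + ((r : ℂ) * Complex.I) • (1 : A)‖ ^ 2 ≤ ‖x‖ ^ 2 + r ^ 2 := by
        rw [sq, ← CStarRing.norm_star_mul_self]
        have : star (x + ((r : ℂ) * Complex.I) • (1 : A)) * (x + ((r : ℂ) * Complex.I) • (1 : A))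
            = x * x + ((r : ℂ) ^ 2) • (1 : A) := by
          simp only [star_add, hsa, star_smul, star_one, add_mul, mul_add, smul_mul_assoc,
            mul_smul_comm, one_mul, mul_one, smul_add, smul_smul]
          simp only [RCLike.star_def, map_mul, Complex.conj_ofReal, Complex.conj_I]
          have : (r : ℂ) * Complex.I * (r * -Complex.I) = (r : ℂ) ^ 2 := by
            ring_nf; simp
          rw [this]
          module
        rw [this]
        refine (norm_add_le _ _).trans ?_
        rw [norm_smul, norm_one, mul_one, sq ‖x‖]
        gcongr
        · exact norm_mul_le _ _
        · simp
      have e2 : ‖f x + r * Complex.I‖ ^ 2 ≤ ‖x‖ ^ 2 + r ^ 2 := by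
        refine le_trans ?_ e
        have := hf (x + ((r : ℂ) * Complex.I) • (1 : A))
        rw [map_add, map_smul, h1, smul_eq_mul, mul_one] at this
        gcongr
      rw [← Complex.normSq_eq_norm_sq, Complex.normSq_apply] at e2
      simp at e2
      nlinarith [sq_nonneg (f x).re, sq_nonneg (f x).im]
    by_contra hne
    have h := key ((‖x‖ ^ 2 + 1) / (2 * (f x).im))
    have : 2 * ((‖x‖ ^ 2 + 1) / (2 * (f x).im)) * (f x).im = ‖x‖ ^ 2 + 1 := by
      field_simp
    linarith
  have hre : 0 ≤ (f x).re := by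
    -- Since `0 ≤ x ≤ ‖x‖`, contractivity puts `f x` within `‖x‖` of `‖x‖`, so its real part is
    -- nonnegative.
    have hle : ‖(‖x‖ : ℂ) • (1 : A) - x‖ ≤ ‖x‖ := by
      have h0 : 0 ≤ algebraMap ℝ A ‖x‖ - x :=
        sub_nonneg.mpr (IsSelfAdjoint.le_algebraMap_norm_self hsa)
      have := (CStarAlgebra.norm_le_iff_le_algebraMap (algebraMap ℝ A ‖x‖ - x)
        (norm_nonneg x) h0).mpr (sub_le_self _ hx0)
      rwa [Algebra.algebraMap_eq_smul_one, ← Complex.coe_smul] at this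
    have h2 := (hf _).trans hle
    rw [map_sub, map_smul, h1, smul_eq_mul, mul_one] at h2
    have h3 := (Complex.abs_re_le_norm _).trans h2
    rw [Complex.sub_re, Complex.ofReal_re] at h3
    linarith [(abs_le.mp h3).2]
  exact Complex.le_def.mpr ⟨hre, by simp [him]⟩

/-- A Hahn-Banach functional norming `1` is contractive and unital, hence positive. -/
instance nonempty_stateSpace [Nontrivial A] : Nonempty (stateSpace A) := by
  obtain ⟨g, hg, hg1⟩ := exists_dual_vector ℂ (1 : A) (by simp)
  have h1 : g 1 = 1 := by simpa using hg1
  refine ⟨⟨StrongDual.toWeakDual g, h1, fun a => ?_⟩⟩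
  exact apply_nonneg_of_norm_le (f := (g : A →ₗ[ℂ] ℂ))
    (fun a => by simpa [hg] using g.le_opNorm a) h1 a

theorem norm_state_apply_le (φ : stateSpace A) (a : selfAdjoint A) :
    ‖(φ : WeakDual ℂ A) a‖ ≤ ‖(a : A)‖ := by
  have h := norm_apply_le_of_isSelfAdjoint
    (f := (WeakDual.toStrongDual (φ : WeakDual ℂ A) : A →ₗ[ℂ] ℂ)) φ.2.2 a.2
  have h1 : (φ : WeakDual ℂ A) 1 = 1 := φ.2.1
  change ‖(φ : WeakDual ℂ A) a‖ ≤ ‖(a : A)‖ * ‖(φ : WeakDual ℂ A) 1‖ at h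
  simpa [h1] using h

/-- Banach-Alaoglu: the defining conditions are weak* closed and bound the norm. -/
instance compactSpace_stateSpace : CompactSpace (stateSpace A) := by
  refine isCompact_iff_compactSpace.mp (WeakDual.isCompact_of_bounded_of_closed ?_ ?_)
  · refine isBounded_iff_forall_norm_le.mpr ⟨2, fun f hf => ?_⟩
    have hf' : f ∈ stateSpace A := hf
    refine ContinuousLinearMap.opNorm_le_bound _ (by norm_num) fun a => ?_
    have h := norm_apply_le (f := (WeakDual.toStrongDual f : A →ₗ[ℂ] ℂ)) hf'.2 a
    have h1 : f 1 = 1 := hf'.1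
    change ‖f a‖ ≤ 2 * ‖a‖ * ‖f 1‖ at h
    simpa [h1] using h
  · have : stateSpace A = {φ | φ 1 = 1} ∩ ⋂ a : A, {φ | 0 ≤ φ (star a * a)} := by
      ext; simp [stateSpace]
    rw [this]
    exact (isClosed_eq (WeakDual.eval_continuous _) continuous_const).inter
      (isClosed_iInter fun a => isClosed_le continuous_const (WeakDual.eval_continuous _))

/-- A positive functional is a multiple of a state. -/
theorem exists_state_smul [Nontrivial A] (f : WeakDual ℂ A) (hf : ∀ a, 0 ≤ f (star a * a)) :
    ∃ φ : stateSpace A, f = f 1 • (φ : WeakDual ℂ A) := by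
  have h1 : 0 ≤ f 1 := by simpa using hf 1
  -- If `f 1 = 0`, the norm bound forces `f = 0`, and any state serves.
  by_cases h0 : f 1 = 0
  · obtain ⟨φ⟩ := nonempty_stateSpace (A := A)
    refine ⟨φ, ?_⟩
    refine DFunLike.ext _ _ fun a => ?_
    have h := norm_apply_le (f := (WeakDual.toStrongDual f : A →ₗ[ℂ] ℂ)) hf a
    change ‖f a‖ ≤ 2 * ‖a‖ * ‖f 1‖ at h
    rw [h0, zero_smul]
    rw [h0, norm_zero, mul_zero] at h
    exact norm_le_zero_iff.mp h
  · refine ⟨⟨(f 1)⁻¹ • f, ?_, fun a => ?_⟩, ?_⟩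
    · change (f 1)⁻¹ * f 1 = 1
      exact inv_mul_cancel₀ h0
    · change 0 ≤ (f 1)⁻¹ * f (star a * a)
      exact mul_nonneg (inv_nonneg.mpr h1) (hf a)
    · rw [smul_smul, mul_inv_cancel₀ h0, one_smul]

theorem isAffineMap_dualMap (f : A →⋆ₐ[ℂ] B) : IsAffineMap (dualMap f) := by
  intro t _ _ φ ψ χ h
  refine DFunLike.ext _ _ fun a => ?_
  exact DFunLike.congr_fun h (f a)

/-- Convex combinations of states. -/
noncomputable def convexComb (t : ℝ) (h0 : 0 ≤ t) (h1 : t ≤ 1) (φ ψ : stateSpace A) :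
    stateSpace A :=
  ⟨(t : ℂ) • (φ : WeakDual ℂ A) + ((1 - t : ℝ) : ℂ) • (ψ : WeakDual ℂ A), by
    refine ⟨?_, fun a => ?_⟩
    · change (t : ℂ) * (φ : WeakDual ℂ A) 1 + ((1 - t : ℝ) : ℂ) * (ψ : WeakDual ℂ A) 1 = 1
      rw [φ.2.1, ψ.2.1]
      push_cast
      ring
    · exact add_nonneg (mul_nonneg (Complex.zero_le_real.mpr h0) (φ.2.2 a))
        (mul_nonneg (Complex.zero_le_real.mpr (sub_nonneg.mpr h1)) (ψ.2.2 a))⟩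

theorem convexComb_apply (t : ℝ) (h0 : 0 ≤ t) (h1 : t ≤ 1) (φ ψ : stateSpace A) (a : A) :
    (convexComb t h0 h1 φ ψ : WeakDual ℂ A) a =
      (t : ℂ) * (φ : WeakDual ℂ A) a + ((1 - t : ℝ) : ℂ) * (ψ : WeakDual ℂ A) a := rfl

end States

/-! ### The Monge-Kantorovich distance and the weak* topology -/

section MongeKantorovich

variable {A : Type*} [CStarAlgebra A] {L : selfAdjoint A → ℝ≥0∞}

theorem mkDist_le_iff {φ ψ : stateSpace A} {r : ℝ≥0∞} :
    mkDist L φ ψ ≤ r ↔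
      ∀ a : selfAdjoint A, L a ≤ 1 → edist ((φ : WeakDual ℂ A) a) ((ψ : WeakDual ℂ A) a) ≤ r :=
  iSup₂_le_iff

theorem edist_apply_le_mkDist (φ ψ : stateSpace A) {a : selfAdjoint A} (ha : L a ≤ 1) :
    edist ((φ : WeakDual ℂ A) a) ((ψ : WeakDual ℂ A) a) ≤ mkDist L φ ψ :=
  mkDist_le_iff.mp le_rfl a ha

theorem edist_apply_le_mul_mkDist (hL : ∀ (r : ℝ) (a : selfAdjoint A), L (r • a) = ‖r‖ₑ * L a)
    (φ ψ : stateSpace A) {a : selfAdjoint A} {c : ℝ≥0} (hc : c ≠ 0) (ha : L a ≤ c) :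
    edist ((φ : WeakDual ℂ A) a) ((ψ : WeakDual ℂ A) a) ≤ c * mkDist L φ ψ := by
  have hc' : (c : ℝ) ≠ 0 := NNReal.coe_ne_zero.mpr hc
  have h : L ((c⁻¹ : ℝ) • a) ≤ 1 := by
    have e : ‖(c : ℝ)‖ₑ = c := by simp [enorm_eq_nnnorm]
    rw [hL, enorm_inv hc', e]
    calc (c : ℝ≥0∞)⁻¹ * L a ≤ (c : ℝ≥0∞)⁻¹ * c := by gcongr
      _ ≤ 1 := ENNReal.inv_mul_le_one _
  have hap : ∀ χ : stateSpace A, (χ : WeakDual ℂ A) a =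
      (c : ℝ) • (χ : WeakDual ℂ A) (((c⁻¹ : ℝ) • a : selfAdjoint A) : A) := by
    intro χ
    have : (a : A) = ((c : ℝ) : ℂ) • (((c⁻¹ : ℝ) • a : selfAdjoint A) : A) := by
      rw [Complex.coe_smul, selfAdjoint.val_smul, smul_smul, mul_inv_cancel₀ hc', one_smul]
    conv_lhs => rw [this, map_smul]
    rw [Complex.coe_smul]
  rw [hap φ, hap ψ, edist_smul₀]
  have e : ‖(c : ℝ)‖₊ = c := by ext; simp
  rw [e, ENNReal.smul_def, smul_eq_mul]
  gcongr
  exact edist_apply_le_mkDist φ ψ h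

/-- Continuity of a map into the state space may be tested on a dense set of self-adjoint
elements. -/
theorem continuous_of_dense_eval {X : Type*} [TopologicalSpace X] {S : Set (selfAdjoint A)}
    (hS : Dense S) {g : X → stateSpace A}
    (hg : ∀ a ∈ S, Continuous fun x => (g x : WeakDual ℂ A) (a : A)) : Continuous g := by
  have hsa : ∀ a : selfAdjoint A, Continuous fun x => (g x : WeakDual ℂ A) (a : A) := by
    intro a
    -- States are contractive on self-adjoint elements, so approximating `a` by `b` in `S` is
    -- uniform over all states.
    refine continuous_of_uniform_approx_of_continuous fun u hu => ?_
    obtain ⟨δ, hδ, hu⟩ := Metric.mem_uniformity_dist.mp hu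
    obtain ⟨b, hb, hab⟩ := hS.exists_dist_lt a hδ
    refine ⟨_, hg b hb, fun x => hu ?_⟩
    rw [dist_eq_norm, ← map_sub]
    refine (norm_state_apply_le (g x) (a - b)).trans_lt ?_
    rw [AddSubgroup.coe_sub, ← dist_eq_norm]
    exact hab
  refine continuous_induced_rng.mpr <| WeakDual.continuous_of_continuous_eval fun a => ?_
  have : (fun x => (g x : WeakDual ℂ A) a) = fun x =>
      (g x : WeakDual ℂ A) (realPart a : A) +
        Complex.I * (g x : WeakDual ℂ A) (imaginaryPart a : A) := by
    funext x
    conv_lhs => rw [← realPart_add_I_smul_imaginaryPart a]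
    simp
  change Continuous fun x => (g x : WeakDual ℂ A) a
  rw [this]
  exact (hsa _).add (continuous_const.mul (hsa _))

/-- Stated for a general target so that `mkSpace L` can be supplied explicitly, against the weak*
topology already on the state space. -/
theorem continuous_of_tendsto_edist {X Y : Type*} [TopologicalSpace X] [PseudoEMetricSpace Y]
    {f : X → Y} (h : ∀ x, Tendsto (fun y => edist (f x) (f y)) (𝓝 x) (𝓝 0)) : Continuous f :=
  continuous_iff_continuousAt.mpr fun x => by
    rw [ContinuousAt, tendsto_iff_edist_tendsto_0]
    simpa only [edist_comm] using h x

theorem continuous_edist_const_left {X : Type*} [PseudoEMetricSpace X] (x : X) :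
    Continuous fun y => edist x y :=
  continuous_const.edist continuous_id

/-- The Monge-Kantorovich distance of a seminorm with dense domain metrizes the weak* topology as
soon as it is weak* continuous. -/
theorem topology_eq_of_tendsto_mkDist
    (hL : ∀ (r : ℝ) (a : selfAdjoint A), L (r • a) = ‖r‖ₑ * L a)
    (hd : Dense {a : selfAdjoint A | L a < ∞})
    (h : ∀ φ : stateSpace A, Tendsto (fun ψ => mkDist L φ ψ) (𝓝 φ) (𝓝 0)) :
    (mkSpace L).toUniformSpace.toTopologicalSpace =
      (instTopologicalSpaceSubtype : TopologicalSpace (stateSpace A)) := by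
  refine le_antisymm (continuous_id_iff_le.mp ?_) (continuous_id_iff_le.mp ?_)
  · refine @continuous_of_dense_eval A _ (stateSpace A)
      (mkSpace L).toUniformSpace.toTopologicalSpace _ hd id fun a ha => ?_
    -- Adding `1` keeps the Lipschitz constant nonzero when `L a = 0`.
    have hfin : L a + 1 ≠ ∞ := ENNReal.add_ne_top.mpr ⟨ha.ne, ENNReal.one_ne_top⟩
    refine @LipschitzWith.continuous (stateSpace A) ℂ (mkSpace L) _ (L a + 1).toNNReal _
      fun φ ψ => ?_
    refine edist_apply_le_mul_mkDist hL φ ψ ?_ ?_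
    · simp [ENNReal.toNNReal_eq_zero_iff, hfin]
    · rw [ENNReal.coe_toNNReal hfin]
      exact le_self_add
  · exact @continuous_of_tendsto_edist (stateSpace A) (stateSpace A) _ (mkSpace L) id h

theorem IsLeibnizQCMS.continuous_mkDist (h : IsLeibnizQCMS A L) (φ : stateSpace A) :
    Continuous fun ψ => mkDist L φ ψ := by
  have : Continuous[(mkSpace L).toUniformSpace.toTopologicalSpace, _] fun ψ => mkDist L φ ψ :=
    @continuous_edist_const_left (stateSpace A) (mkSpace L) φ
  rwa [h.metrizes] at this

theorem mkDist_self (φ : stateSpace A) : mkDist L φ φ = 0 := (mkSpace L).edist_self φ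

/-- A continuous finite function on a compact space attains a finite maximum. -/
theorem IsLeibnizQCMS.exists_mkDist_le (h : IsLeibnizQCMS A L) (φ : stateSpace A) :
    ∃ C : ℝ≥0∞, C ≠ ∞ ∧ ∀ ψ, mkDist L φ ψ ≤ C := by
  obtain ⟨ψ, -, hψ⟩ := isCompact_univ.exists_isMaxOn ⟨φ, Set.mem_univ φ⟩
    (h.continuous_mkDist φ).continuousOn
  exact ⟨mkDist L φ ψ, h.mkDist_ne_top φ ψ, fun χ => hψ (Set.mem_univ χ)⟩

/-- Only one half of the Hausdorff distance matters, as `S` lies in the whole space. -/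
theorem mkHausdorff_univ_le {S : Set (stateSpace A)} {r : ℝ≥0∞}
    (h : ∀ φ, ∃ ψ ∈ S, mkDist L φ ψ ≤ r) : mkHausdorff L Set.univ S ≤ r :=
  @Metric.hausdorffEDist_le_of_mem_edist _ (mkSpace L) _ _ _ (fun φ _ => h φ)
    fun φ _ => ⟨φ, Set.mem_univ φ, ((mkSpace L).edist_self φ).trans_le zero_le⟩

theorem exists_mkDist_lt_of_mkHausdorff_lt {S : Set (stateSpace A)} {r : ℝ≥0∞}
    (h : mkHausdorff L Set.univ S < r) (φ : stateSpace A) : ∃ ψ ∈ S, mkDist L φ ψ < r :=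
  @Metric.exists_edist_lt_of_hausdorffEDist_lt _ (mkSpace L) φ _ _ _ (Set.mem_univ φ) h

theorem IsLeibnizQCMS.mkHausdorff_ne_top (h : IsLeibnizQCMS A L) {S : Set (stateSpace A)}
    (hS : S.Nonempty) : mkHausdorff L Set.univ S ≠ ∞ := by
  obtain ⟨φ, hφ⟩ := hS
  obtain ⟨C, hC, hle⟩ := h.exists_mkDist_le φ
  refine ((mkHausdorff_univ_le fun ψ => ⟨φ, hφ, ?_⟩).trans_lt hC.lt_top).ne
  exact ((mkSpace L).edist_comm ψ φ).trans_le (hle ψ)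

theorem IsTunnel.extent_ne_top {B D : Type*} [CStarAlgebra B] [CStarAlgebra D]
    [Nontrivial A] [Nontrivial B] {LA : selfAdjoint A → ℝ≥0∞} {LB : selfAdjoint B → ℝ≥0∞}
    {LD : selfAdjoint D → ℝ≥0∞} {π : D →⋆ₐ[ℂ] A} {ρ : D →⋆ₐ[ℂ] B}
    (h : IsTunnel LA LB LD π ρ) : extent LD π ρ ≠ ∞ :=
  (max_lt (h.isLeibnizQCMS.mkHausdorff_ne_top (Set.range_nonempty _)).lt_top
    (h.isLeibnizQCMS.mkHausdorff_ne_top (Set.range_nonempty _)).lt_top).ne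

end MongeKantorovich

/-! ### Quantum isometries and the abstract extent estimate -/

section Lifting

variable {A B D D₁ D₂ : Type*} [CStarAlgebra A] [CStarAlgebra B] [CStarAlgebra D]
  [CStarAlgebra D₁] [CStarAlgebra D₂]
  {L : selfAdjoint D → ℝ≥0∞} {L₁ : selfAdjoint D₁ → ℝ≥0∞} {L₂ : selfAdjoint D₂ → ℝ≥0∞}

/-- Push `d` down to `B`, where the two quotient seminorms coincide, and lift back. The bound is
strict because the infimum need not be attained. -/
theorem exists_lt_and_saMap_eq {LB : selfAdjoint B → ℝ≥0∞} {π : D₁ →⋆ₐ[ℂ] B} {ρ : D₂ →⋆ₐ[ℂ] B}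
    (hπ : ∀ b, LB b = ⨅ (d : selfAdjoint D₁) (_ : saMap π d = b), L₁ d)
    (hρ : ∀ b, LB b = ⨅ (d : selfAdjoint D₂) (_ : saMap ρ d = b), L₂ d)
    {d : selfAdjoint D₁} {r : ℝ≥0∞} (hd : L₁ d < r) :
    ∃ d' : selfAdjoint D₂, L₂ d' < r ∧ saMap ρ d' = saMap π d := by
  have h : LB (saMap π d) < r := by
    rw [hπ]
    exact (iInf₂_le (f := fun (d' : selfAdjoint D₁) (_ : saMap π d' = saMap π d) => L₁ d') d
      rfl).trans_lt hd
  rw [hρ] at h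
  obtain ⟨d', h⟩ := iInf_lt_iff.mp h
  obtain ⟨h', h⟩ := iInf_lt_iff.mp h
  exact ⟨d', h, h'⟩

theorem eq_iInf_comp {LA : selfAdjoint A → ℝ≥0∞} {π : D₁ →⋆ₐ[ℂ] A} {η : D →⋆ₐ[ℂ] D₁}
    (hπ : ∀ a, LA a = ⨅ (d : selfAdjoint D₁) (_ : saMap π d = a), L₁ d)
    (hle : ∀ d, L₁ (saMap η d) ≤ L d)
    (hlift : ∀ d₁ r, L₁ d₁ < r → ∃ d, saMap η d = d₁ ∧ L d < r) (a : selfAdjoint A) :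
    LA a = ⨅ (d : selfAdjoint D) (_ : saMap (π.comp η) d = a), L d := by
  refine le_antisymm (le_iInf₂ fun d hd => ?_) (le_of_forall_gt fun r hr => ?_)
  · exact ((hπ a).trans_le (iInf₂_le (saMap η d) hd)).trans (hle d)
  · rw [hπ] at hr
    obtain ⟨d₁, hr⟩ := iInf_lt_iff.mp hr
    obtain ⟨h₁, hr⟩ := iInf_lt_iff.mp hr
    obtain ⟨d, hd, hr⟩ := hlift d₁ r hr
    refine (iInf₂_le d ?_).trans_lt hr
    rw [← h₁, ← hd]
    rfl

/-- `η` carries the unit ball of `L` into that of `L₁`. -/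
theorem mkDist_dualMap_le {η : D →⋆ₐ[ℂ] D₁} (hle : ∀ d, L₁ (saMap η d) ≤ L d)
    (φ ψ : stateSpace D₁) : mkDist L (dualMap η φ) (dualMap η ψ) ≤ mkDist L₁ φ ψ :=
  mkDist_le_iff.mpr fun d hd =>
    edist_apply_le_mkDist (L := L₁) φ ψ (a := saMap η d) ((hle d).trans hd)

/-- The transpose of a quantum isometry is an isometry. -/
theorem mkDist_dualMap_eq {η : D →⋆ₐ[ℂ] D₁} (hL : IsLeibnizQCMS D L)
    (hle : ∀ d, L₁ (saMap η d) ≤ L d)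
    (hlift : ∀ d₁ r, L₁ d₁ < r → ∃ d, saMap η d = d₁ ∧ L d < r) (φ ψ : stateSpace D₁) :
    mkDist L (dualMap η φ) (dualMap η ψ) = mkDist L₁ φ ψ := by
  refine le_antisymm (mkDist_dualMap_le hle φ ψ) (mkDist_le_iff.mpr fun a ha => ?_)
  -- Elements of the unit ball lift only with seminorm below each `c > 1`, so `c` is sent to `1`.
  have hlim : Tendsto (fun c : ℝ≥0 => (c : ℝ≥0∞) * mkDist L (dualMap η φ) (dualMap η ψ))
      (𝓝[>] 1) (𝓝 (((1 : ℝ≥0) : ℝ≥0∞) * mkDist L (dualMap η φ) (dualMap η ψ))) :=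
    ENNReal.Tendsto.mul_const
      (ENNReal.continuous_coe.continuousAt.tendsto.mono_left nhdsWithin_le_nhds)
      (Or.inr (hL.mkDist_ne_top _ _))
  rw [ENNReal.coe_one, one_mul] at hlim
  refine ge_of_tendsto hlim (eventually_nhdsWithin_of_forall fun c hc => ?_)
  have hc' : (1 : ℝ≥0) < c := hc
  obtain ⟨d, rfl, hd⟩ := hlift a c (ha.trans_lt (by exact_mod_cast hc'))
  exact edist_apply_le_mul_mkDist hL.smul_eq (dualMap η φ) (dualMap η ψ)
    (zero_lt_one.trans hc').ne' hd.le

theorem convexComb_comm (t : ℝ) (h0 : 0 ≤ t) (h1 : t ≤ 1) (φ ψ : stateSpace A) :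
    convexComb t h0 h1 φ ψ = convexComb (1 - t) (sub_nonneg.mpr h1) (sub_le_self 1 h0) ψ φ := by
  refine Subtype.ext (DFunLike.ext _ _ fun a => ?_)
  rw [convexComb_apply, convexComb_apply, sub_sub_cancel, add_comm]

/-- The common part cancels and the remaining weight `1 - t` is at most `1`. -/
theorem mkDist_convexComb_le {L : selfAdjoint A → ℝ≥0∞} (t : ℝ) (h0 : 0 ≤ t) (h1 : t ≤ 1)
    (φ ψ χ : stateSpace A) :
    mkDist L (convexComb t h0 h1 φ ψ) (convexComb t h0 h1 φ χ) ≤ mkDist L ψ χ := by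
  refine mkDist_le_iff.mpr fun a ha => le_trans ?_ (edist_apply_le_mkDist ψ χ ha)
  rw [convexComb_apply, convexComb_apply, edist_add_left, edist_eq_enorm_sub, edist_eq_enorm_sub,
    ← mul_sub, enorm_mul]
  refine mul_le_of_le_one_left' ?_
  rw [← ofReal_norm, Complex.norm_real, Real.norm_of_nonneg (sub_nonneg.mpr h1)]
  exact ENNReal.ofReal_le_one.mpr (sub_le_self 1 h0)

theorem dualMap_convexComb (η : D →⋆ₐ[ℂ] A) (t : ℝ) (h0 : 0 ≤ t) (h1 : t ≤ 1)
    (φ ψ : stateSpace A) :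
    dualMap η (convexComb t h0 h1 φ ψ) = convexComb t h0 h1 (dualMap η φ) (dualMap η ψ) := rfl

theorem mkDist_triangle {L : selfAdjoint A → ℝ≥0∞} (φ ψ χ : stateSpace A) :
    mkDist L φ χ ≤ mkDist L φ ψ + mkDist L ψ χ :=
  (mkSpace L).edist_triangle φ ψ χ

theorem mkDist_comm {L : selfAdjoint A → ℝ≥0∞} (φ ψ : stateSpace A) :
    mkDist L φ ψ = mkDist L ψ φ :=
  (mkSpace L).edist_comm φ ψ

/-- Kept abstract in `η₁` and `η₂` so that it applies again with the two summands exchanged. -/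
theorem mkHausdorff_comp_le {η₁ : D →⋆ₐ[ℂ] D₁} {η₂ : D →⋆ₐ[ℂ] D₂} {π₁ : D₁ →⋆ₐ[ℂ] A}
    {π₂ : D₁ →⋆ₐ[ℂ] B} {ρ₁ : D₂ →⋆ₐ[ℂ] B} {r : ℝ≥0∞}
    (hle₁ : ∀ d, L₁ (saMap η₁ d) ≤ L d) (hle₂ : ∀ d, L₂ (saMap η₂ d) ≤ L d)
    (hr : ∀ μ, mkDist L (dualMap (ρ₁.comp η₂) μ) (dualMap (π₂.comp η₁) μ) ≤ r)
    (hdec : ∀ χ : stateSpace D, ∃ t h0 h1 φ₁ φ₂,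
      χ = convexComb t h0 h1 (dualMap η₁ φ₁) (dualMap η₂ φ₂)) :
    mkHausdorff L Set.univ (Set.range (dualMap (π₁.comp η₁))) ≤
      mkHausdorff L₁ Set.univ (Set.range (dualMap π₁)) +
        mkHausdorff L₂ Set.univ (Set.range (dualMap ρ₁)) + r := by
  refine ENNReal.le_of_forall_pos_le_add fun δ hδ hfin => ?_
  have hfin' := (ENNReal.add_lt_top.mp (ENNReal.add_lt_top.mp hfin).1)
  have hδ' : ((δ / 2 : ℝ≥0) : ℝ≥0∞) ≠ 0 := by
    simpa using hδ.ne'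
  have hsum : (δ : ℝ≥0∞) = (δ / 2 : ℝ≥0) + (δ / 2 : ℝ≥0) := by
    rw [← ENNReal.coe_add, add_halves]
  refine mkHausdorff_univ_le fun χ => ?_
  obtain ⟨t, h0, h1, φ₁, φ₂, rfl⟩ := hdec χ
  obtain ⟨_, ⟨μ, rfl⟩, hμ⟩ :=
    exists_mkDist_lt_of_mkHausdorff_lt (ENNReal.lt_add_right hfin'.2.ne hδ') φ₂
  obtain ⟨_, ⟨ν, rfl⟩, hν⟩ :=
    -- Once `φ₂` is traded for `μ ∘ π₂`, the whole mixture is a state of `D₁`, so a single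
    -- approximation by a state of `A` suffices.
    exists_mkDist_lt_of_mkHausdorff_lt (ENNReal.lt_add_right hfin'.1.ne hδ')
      (convexComb t h0 h1 φ₁ (dualMap π₂ μ))
  refine ⟨_, ⟨ν, rfl⟩, ?_⟩
  have e₁ : mkDist L (dualMap η₂ φ₂) (dualMap η₁ (dualMap π₂ μ)) ≤
      mkHausdorff L₂ Set.univ (Set.range (dualMap ρ₁)) + (δ / 2 : ℝ≥0) + r :=
    (mkDist_triangle _ (dualMap η₂ (dualMap ρ₁ μ)) _).trans
      (add_le_add ((mkDist_dualMap_le hle₂ _ _).trans hμ.le) (hr μ))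
  have e₂ := (mkDist_convexComb_le t h0 h1 (dualMap η₁ φ₁) _ _).trans e₁
  have e₃ := (mkDist_dualMap_le hle₁ _ _).trans hν.le
  rw [dualMap_convexComb] at e₃
  refine ((mkDist_triangle _ _ _).trans (add_le_add e₂ e₃)).trans_eq ?_
  rw [hsum]
  ring

end Lifting

/-! ### States of a direct sum -/

section DirectSum

variable {D₁ D₂ : Type*} [CStarAlgebra D₁] [CStarAlgebra D₂]

/-- The self-adjoint element of a direct sum with given coordinates. -/
def saPair (a : selfAdjoint D₁) (b : selfAdjoint D₂) : selfAdjoint (D₁ × D₂) :=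
  ⟨(a, b), Prod.ext a.2 b.2⟩

/-- The restriction of a functional on a direct sum to the first summand. -/
noncomputable def restrictFst (χ : WeakDual ℂ (D₁ × D₂)) : WeakDual ℂ D₁ :=
  StrongDual.toWeakDual ((WeakDual.toStrongDual χ).comp (ContinuousLinearMap.inl ℂ D₁ D₂))

/-- The restriction of a functional on a direct sum to the second summand. -/
noncomputable def restrictSnd (χ : WeakDual ℂ (D₁ × D₂)) : WeakDual ℂ D₂ :=
  StrongDual.toWeakDual ((WeakDual.toStrongDual χ).comp (ContinuousLinearMap.inr ℂ D₁ D₂))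

theorem restrictFst_apply (χ : WeakDual ℂ (D₁ × D₂)) (a : D₁) : restrictFst χ a = χ (a, 0) := rfl

theorem restrictSnd_apply (χ : WeakDual ℂ (D₁ × D₂)) (b : D₂) : restrictSnd χ b = χ (0, b) := rfl

theorem restrictFst_add_restrictSnd (χ : WeakDual ℂ (D₁ × D₂)) (d : D₁ × D₂) :
    restrictFst χ d.1 + restrictSnd χ d.2 = χ d := by
  rw [restrictFst_apply, restrictSnd_apply, ← map_add]
  simp

theorem restrictFst_nonneg (χ : stateSpace (D₁ × D₂)) (a : D₁) :
    0 ≤ restrictFst (χ : WeakDual ℂ (D₁ × D₂)) (star a * a) := by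
  have h := χ.2.2 (a, 0)
  rwa [show star ((a, 0) : D₁ × D₂) * (a, 0) = (star a * a, 0) from
    Prod.ext rfl (by simp)] at h

theorem restrictSnd_nonneg (χ : stateSpace (D₁ × D₂)) (b : D₂) :
    0 ≤ restrictSnd (χ : WeakDual ℂ (D₁ × D₂)) (star b * b) := by
  have h := χ.2.2 (0, b)
  rwa [show star ((0, b) : D₁ × D₂) * (0, b) = (0, star b * b) from
    Prod.ext (by simp) rfl] at h

theorem restrictFst_one_nonneg (χ : stateSpace (D₁ × D₂)) :
    0 ≤ restrictFst (χ : WeakDual ℂ (D₁ × D₂)) 1 := by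
  simpa using restrictFst_nonneg χ 1

theorem restrictSnd_one_nonneg (χ : stateSpace (D₁ × D₂)) :
    0 ≤ restrictSnd (χ : WeakDual ℂ (D₁ × D₂)) 1 := by
  simpa using restrictSnd_nonneg χ 1

theorem restrictFst_one_add (χ : stateSpace (D₁ × D₂)) :
    restrictFst (χ : WeakDual ℂ (D₁ × D₂)) 1 + restrictSnd (χ : WeakDual ℂ (D₁ × D₂)) 1 = 1 :=
  (restrictFst_add_restrictSnd _ (1 : D₁ × D₂)).trans χ.2.1

/-- A state of a direct sum is a convex combination of states of the summands. -/
theorem exists_eq_convexComb [Nontrivial D₁] [Nontrivial D₂] (χ : stateSpace (D₁ × D₂)) :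
    ∃ t h0 h1 φ₁ φ₂,
      χ = convexComb t h0 h1 (dualMap (projFst D₁ D₂) φ₁) (dualMap (projSnd D₁ D₂) φ₂) := by
  obtain ⟨φ₁, hφ₁⟩ := exists_state_smul (restrictFst (χ : WeakDual ℂ (D₁ × D₂)))
    (restrictFst_nonneg χ)
  obtain ⟨φ₂, hφ₂⟩ := exists_state_smul (restrictSnd (χ : WeakDual ℂ (D₁ × D₂)))
    (restrictSnd_nonneg χ)
  have p₁ := restrictFst_one_nonneg χ
  have p₂ := restrictSnd_one_nonneg χ
  have hs := restrictFst_one_add χ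
  set s := restrictFst (χ : WeakDual ℂ (D₁ × D₂)) 1 with hs1
  set s' := restrictSnd (χ : WeakDual ℂ (D₁ × D₂)) 1 with hs2
  -- The mixing weight is `χ (1, 0)`, which is real because it is nonnegative.
  have hsr : (s.re : ℂ) = s := Complex.ext rfl (Complex.nonneg_iff.mp p₁).2
  have hs' : s' = ((1 - s.re : ℝ) : ℂ) := by
    push_cast
    rw [hsr, ← hs]
    ring
  have h1 : 0 ≤ 1 - s.re := by
    rw [hs'] at p₂
    exact Complex.zero_le_real.mp p₂
  refine ⟨s.re, (Complex.nonneg_iff.mp p₁).1, sub_nonneg.mp h1, φ₁, φ₂,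
    Subtype.ext (DFunLike.ext _ _ fun d => ?_)⟩
  rw [convexComb_apply, dualMap_apply, dualMap_apply, ← restrictFst_add_restrictSnd, hφ₁, hφ₂,
    hsr, ← hs']
  rfl

/-- The state `χ(·, 0) + χ(0, 1) μ` of the first summand. -/
noncomputable def retractFst (μ : stateSpace D₁) (χ : stateSpace (D₁ × D₂)) : stateSpace D₁ :=
  ⟨restrictFst (χ : WeakDual ℂ (D₁ × D₂)) +
      restrictSnd (χ : WeakDual ℂ (D₁ × D₂)) 1 • (μ : WeakDual ℂ D₁), by
    refine ⟨?_, fun a => ?_⟩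
    · change restrictFst (χ : WeakDual ℂ (D₁ × D₂)) 1 +
        restrictSnd (χ : WeakDual ℂ (D₁ × D₂)) 1 * (μ : WeakDual ℂ D₁) 1 = 1
      rw [μ.2.1, mul_one, restrictFst_one_add]
    · exact add_nonneg (restrictFst_nonneg χ a)
        (mul_nonneg (restrictSnd_one_nonneg χ) (μ.2.2 a))⟩

/-- The state `χ(0, ·) + χ(1, 0) μ` of the second summand. -/
noncomputable def retractSnd (μ : stateSpace D₂) (χ : stateSpace (D₁ × D₂)) : stateSpace D₂ :=
  ⟨restrictSnd (χ : WeakDual ℂ (D₁ × D₂)) +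
      restrictFst (χ : WeakDual ℂ (D₁ × D₂)) 1 • (μ : WeakDual ℂ D₂), by
    refine ⟨?_, fun a => ?_⟩
    · change restrictSnd (χ : WeakDual ℂ (D₁ × D₂)) 1 +
        restrictFst (χ : WeakDual ℂ (D₁ × D₂)) 1 * (μ : WeakDual ℂ D₂) 1 = 1
      rw [μ.2.1, mul_one, add_comm, restrictFst_one_add]
    · exact add_nonneg (restrictSnd_nonneg χ a)
        (mul_nonneg (restrictFst_one_nonneg χ) (μ.2.2 a))⟩

theorem retractFst_apply (μ : stateSpace D₁) (χ : stateSpace (D₁ × D₂)) (a : D₁) :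
    (retractFst μ χ : WeakDual ℂ D₁) a =
      (χ : WeakDual ℂ (D₁ × D₂)) (a, 0) +
        (χ : WeakDual ℂ (D₁ × D₂)) (0, 1) * (μ : WeakDual ℂ D₁) a := rfl

theorem retractSnd_apply (μ : stateSpace D₂) (χ : stateSpace (D₁ × D₂)) (b : D₂) :
    (retractSnd μ χ : WeakDual ℂ D₂) b =
      (χ : WeakDual ℂ (D₁ × D₂)) (0, b) +
        (χ : WeakDual ℂ (D₁ × D₂)) (1, 0) * (μ : WeakDual ℂ D₂) b := rfl

theorem continuous_state_apply {A : Type*} [CStarAlgebra A] (a : A) :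
    Continuous fun φ : stateSpace A => (φ : WeakDual ℂ A) a :=
  (WeakDual.eval_continuous a).comp continuous_subtype_val

theorem continuous_retractFst (μ : stateSpace D₁) :
    Continuous (retractFst μ : stateSpace (D₁ × D₂) → stateSpace D₁) :=
  continuous_induced_rng.mpr <| WeakDual.continuous_of_continuous_eval fun _ =>
    (continuous_state_apply _).add ((continuous_state_apply _).mul continuous_const)

theorem continuous_retractSnd (μ : stateSpace D₂) :
    Continuous (retractSnd μ : stateSpace (D₁ × D₂) → stateSpace D₂) :=
  continuous_induced_rng.mpr <| WeakDual.continuous_of_continuous_eval fun _ =>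
    (continuous_state_apply _).add ((continuous_state_apply _).mul continuous_const)

end DirectSum

/-! ### The composed seminorm: lifts, metric and topology -/

section ComposedSeminorm

variable {A B E D₁ D₂ : Type*} [CStarAlgebra A] [CStarAlgebra B] [CStarAlgebra E]
  [CStarAlgebra D₁] [CStarAlgebra D₂]
  {LA : selfAdjoint A → ℝ≥0∞} {LB : selfAdjoint B → ℝ≥0∞} {LE : selfAdjoint E → ℝ≥0∞}
  {L₁ : selfAdjoint D₁ → ℝ≥0∞} {L₂ : selfAdjoint D₂ → ℝ≥0∞}
  {π₁ : D₁ →⋆ₐ[ℂ] A} {π₂ : D₁ →⋆ₐ[ℂ] B} {ρ₁ : D₂ →⋆ₐ[ℂ] B} {ρ₂ : D₂ →⋆ₐ[ℂ] E} {ε : ℝ}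

theorem le_composedSeminorm_fst (d : selfAdjoint (D₁ × D₂)) :
    L₁ (saMap (projFst D₁ D₂) d) ≤ composedSeminorm L₁ L₂ π₂ ρ₁ ε d :=
  (le_max_left _ _).trans (le_max_left _ _)

theorem le_composedSeminorm_snd (d : selfAdjoint (D₁ × D₂)) :
    L₂ (saMap (projSnd D₁ D₂) d) ≤ composedSeminorm L₁ L₂ π₂ ρ₁ ε d :=
  (le_max_right _ _).trans (le_max_left _ _)

theorem composedSeminorm_saPair {a : selfAdjoint D₁} {b : selfAdjoint D₂}
    (h : saMap π₂ a = saMap ρ₁ b) :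
    composedSeminorm L₁ L₂ π₂ ρ₁ ε (saPair a b) = max (L₁ a) (L₂ b) := by
  have h' : π₂ (a : D₁) - ρ₁ (b : D₂) = 0 := sub_eq_zero.mpr (congrArg Subtype.val h)
  change max (max (L₁ a) (L₂ b)) (ENNReal.ofReal (1 / ε * ‖π₂ (a : D₁) - ρ₁ (b : D₂)‖)) = _
  rw [h']
  simp

theorem exists_saMap_fst_eq (h₁ : IsTunnel LA LB L₁ π₁ π₂) (h₂ : IsTunnel LB LE L₂ ρ₁ ρ₂)
    (a : selfAdjoint D₁) (r : ℝ≥0∞) (ha : L₁ a < r) :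
    ∃ d, saMap (projFst D₁ D₂) d = a ∧ composedSeminorm L₁ L₂ π₂ ρ₁ ε d < r := by
  obtain ⟨b, hb, hab⟩ := exists_lt_and_saMap_eq h₁.quotient_right h₂.quotient_left ha
  exact ⟨saPair a b, rfl, (composedSeminorm_saPair hab.symm).trans_lt (max_lt ha hb)⟩

theorem exists_saMap_snd_eq (h₁ : IsTunnel LA LB L₁ π₁ π₂) (h₂ : IsTunnel LB LE L₂ ρ₁ ρ₂)
    (b : selfAdjoint D₂) (r : ℝ≥0∞) (hb : L₂ b < r) :
    ∃ d, saMap (projSnd D₁ D₂) d = b ∧ composedSeminorm L₁ L₂ π₂ ρ₁ ε d < r := by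
  obtain ⟨a, ha, hab⟩ := exists_lt_and_saMap_eq h₂.quotient_left h₁.quotient_right hb
  exact ⟨saPair a b, rfl, (composedSeminorm_saPair hab).trans_lt (max_lt ha hb)⟩

theorem norm_sub_le_of_composedSeminorm_le_one (hε : 0 < ε) {d : selfAdjoint (D₁ × D₂)}
    (hd : composedSeminorm L₁ L₂ π₂ ρ₁ ε d ≤ 1) :
    ‖π₂ (d : D₁ × D₂).1 - ρ₁ (d : D₁ × D₂).2‖ ≤ ε := by
  have h := ENNReal.ofReal_le_one.mp ((le_max_right _ _).trans hd)
  rwa [one_div, inv_mul_le_iff₀ hε, mul_one] at h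

theorem edist_dualMap_apply_le (hε : 0 < ε) {d : selfAdjoint (D₁ × D₂)}
    (hd : composedSeminorm L₁ L₂ π₂ ρ₁ ε d ≤ 1) (μ : stateSpace B) :
    edist ((dualMap π₂ μ : WeakDual ℂ D₁) (d : D₁ × D₂).1)
      ((dualMap ρ₁ μ : WeakDual ℂ D₂) (d : D₁ × D₂).2) ≤ ENNReal.ofReal ε := by
  rw [dualMap_apply, dualMap_apply, edist_dist, dist_eq_norm, ← map_sub]
  refine ENNReal.ofReal_le_ofReal (le_trans ?_ (norm_sub_le_of_composedSeminorm_le_one hε hd))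
  exact norm_state_apply_le μ (saMap π₂ (saMap (projFst D₁ D₂) d) -
    saMap ρ₁ (saMap (projSnd D₁ D₂) d))

theorem mkDist_dualMap_comp_le (hε : 0 < ε) (μ : stateSpace B) :
    mkDist (composedSeminorm L₁ L₂ π₂ ρ₁ ε) (dualMap (π₂.comp (projFst D₁ D₂)) μ)
      (dualMap (ρ₁.comp (projSnd D₁ D₂)) μ) ≤ ENNReal.ofReal ε :=
  mkDist_le_iff.mpr fun _ hd => edist_dualMap_apply_le hε hd μ

/-- Adding the two retracts of `χ` overcounts `χ d` by a mixture of `μ (π₂ d₁)` and `μ (ρ₁ d₂)` with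
weights `χ (0, 1)` and `χ (1, 0)`. Between two states this excess changes by a multiple of `μ (π₂ d₁
- ρ₁ d₂)`, which is at most `ε` in modulus on the unit ball. -/
theorem mkDist_composedSeminorm_le (hε : 0 < ε) (μ : stateSpace B)
    (φ ψ : stateSpace (D₁ × D₂)) :
    mkDist (composedSeminorm L₁ L₂ π₂ ρ₁ ε) φ ψ ≤
      mkDist L₁ (retractFst (dualMap π₂ μ) φ) (retractFst (dualMap π₂ μ) ψ) +
        mkDist L₂ (retractSnd (dualMap ρ₁ μ) φ) (retractSnd (dualMap ρ₁ μ) ψ) +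
        ENNReal.ofReal ε *
          edist ((φ : WeakDual ℂ (D₁ × D₂)) (1, 0)) ((ψ : WeakDual ℂ (D₁ × D₂)) (1, 0)) := by
  refine mkDist_le_iff.mpr fun d hd => ?_
  have b₁ := edist_apply_le_mkDist (L := L₁) (retractFst (dualMap π₂ μ) φ)
    (retractFst (dualMap π₂ μ) ψ) ((le_composedSeminorm_fst d).trans hd)
  have b₂ := edist_apply_le_mkDist (L := L₂) (retractSnd (dualMap ρ₁ μ) φ)
    (retractSnd (dualMap ρ₁ μ) ψ) ((le_composedSeminorm_snd d).trans hd)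
  have b₃ := edist_dualMap_apply_le hε hd μ
  refine le_trans ?_ (add_le_add (add_le_add b₁ b₂) (mul_le_mul_left b₃ _))
  simp only [edist_eq_enorm_sub]
  rw [← enorm_mul]
  refine le_trans (le_of_eq ?_) ((enorm_add_le _ _).trans
    (add_le_add_left (enorm_add_le _ _) _))
  have hs : ∀ χ : stateSpace (D₁ × D₂), (χ : WeakDual ℂ (D₁ × D₂)) (0, 1) =
      1 - (χ : WeakDual ℂ (D₁ × D₂)) (1, 0) := fun χ =>
    eq_sub_of_add_eq' (restrictFst_one_add χ)
  congr 1
  rw [← restrictFst_add_restrictSnd (φ : WeakDual ℂ (D₁ × D₂)) d,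
    ← restrictFst_add_restrictSnd (ψ : WeakDual ℂ (D₁ × D₂)) d]
  change _ = (retractFst (dualMap π₂ μ) φ : WeakDual ℂ D₁) (d : D₁ × D₂).1 -
      (retractFst (dualMap π₂ μ) ψ : WeakDual ℂ D₁) (d : D₁ × D₂).1 +
    ((retractSnd (dualMap ρ₁ μ) φ : WeakDual ℂ D₂) (d : D₁ × D₂).2 -
      (retractSnd (dualMap ρ₁ μ) ψ : WeakDual ℂ D₂) (d : D₁ × D₂).2) + _
  simp only [retractFst_apply, retractSnd_apply, restrictFst_apply, restrictSnd_apply, hs]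
  ring

theorem mkDist_composedSeminorm_ne_top (h₁ : IsLeibnizQCMS D₁ L₁) (h₂ : IsLeibnizQCMS D₂ L₂)
    (hε : 0 < ε) (μ : stateSpace B) (φ ψ : stateSpace (D₁ × D₂)) :
    mkDist (composedSeminorm L₁ L₂ π₂ ρ₁ ε) φ ψ ≠ ∞ :=
  ne_top_of_le_ne_top (ENNReal.add_ne_top.mpr ⟨ENNReal.add_ne_top.mpr
    ⟨h₁.mkDist_ne_top _ _, h₂.mkDist_ne_top _ _⟩,
    ENNReal.mul_ne_top ENNReal.ofReal_ne_top (edist_ne_top _ _)⟩)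
    (mkDist_composedSeminorm_le hε μ φ ψ)

theorem tendsto_mkDist_composedSeminorm (h₁ : IsLeibnizQCMS D₁ L₁) (h₂ : IsLeibnizQCMS D₂ L₂)
    (hε : 0 < ε) (μ : stateSpace B) (φ : stateSpace (D₁ × D₂)) :
    Tendsto (fun ψ => mkDist (composedSeminorm L₁ L₂ π₂ ρ₁ ε) φ ψ) (𝓝 φ) (𝓝 0) := by
  refine tendsto_of_tendsto_of_tendsto_of_le_of_le tendsto_const_nhds ?_ (fun _ => zero_le)
    (mkDist_composedSeminorm_le hε μ φ)
  -- Each term of the bound is weak* continuous in `ψ` and vanishes at `φ`.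
  have hc := (((h₁.continuous_mkDist (retractFst (dualMap π₂ μ) φ)).comp
    (continuous_retractFst (dualMap π₂ μ))).add
    ((h₂.continuous_mkDist (retractSnd (dualMap ρ₁ μ) φ)).comp
      (continuous_retractSnd (dualMap ρ₁ μ)))).add
    ((ENNReal.continuous_const_mul (ENNReal.ofReal_ne_top (r := ε))).comp
      ((continuous_edist_const_left ((φ : WeakDual ℂ (D₁ × D₂)) (1, 0))).comp
        (continuous_state_apply (1, 0))))
  have h := hc.tendsto φ
  simp only [Pi.add_apply, Function.comp_apply, mkDist_self, edist_self, mul_zero, add_zero] at h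
  exact h

/-! ### Leibniz inequalities and the remaining axioms -/

theorem norm_mul_sub_mul_le {x y x' y' : B} {p q : ℝ} (hx : ‖x‖ ≤ p) (hy : ‖y'‖ ≤ q) :
    ‖x * y - x' * y'‖ ≤ p * ‖y - y'‖ + q * ‖x - x'‖ := by
  -- This telescoping involves only `‖x‖` and `‖y'‖`, one from each summand, both controlled by the
  -- maximum norm.
  calc ‖x * y - x' * y'‖ = ‖x * (y - y') + (x - x') * y'‖ := by
        congr 1
        noncomm_ring
    _ ≤ ‖x‖ * ‖y - y'‖ + ‖x - x'‖ * ‖y'‖ :=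
        (norm_add_le _ _).trans (add_le_add (norm_mul_le _ _) (norm_mul_le _ _))
    _ ≤ p * ‖y - y'‖ + ‖x - x'‖ * q := by gcongr
    _ = _ := by ring

theorem norm_map_fst_le (d : D₁ × D₂) : ‖π₂ d.1‖ ≤ ‖d‖ :=
  (NonUnitalStarAlgHom.norm_apply_le π₂ d.1).trans (norm_fst_le d)

theorem norm_map_snd_le (d : D₁ × D₂) : ‖ρ₁ d.2‖ ≤ ‖d‖ :=
  (NonUnitalStarAlgHom.norm_apply_le ρ₁ d.2).trans (norm_snd_le d)

theorem norm_mul_defect_le (a b : D₁ × D₂) :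
    ‖π₂ (a * b).1 - ρ₁ (a * b).2‖ ≤ ‖a‖ * ‖π₂ b.1 - ρ₁ b.2‖ + ‖b‖ * ‖π₂ a.1 - ρ₁ a.2‖ := by
  rw [Prod.fst_mul, Prod.snd_mul, map_mul, map_mul]
  exact norm_mul_sub_mul_le (norm_map_fst_le a) (norm_map_snd_le b)

/-- The bound for `ab` is symmetric in `a` and `b`, so averaging with `ba` preserves it. -/
theorem norm_jordan_defect_le (a b : selfAdjoint (D₁ × D₂)) :
    ‖π₂ (jordan a b : D₁ × D₂).1 - ρ₁ (jordan a b : D₁ × D₂).2‖ ≤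
      ‖(a : D₁ × D₂)‖ * ‖π₂ (b : D₁ × D₂).1 - ρ₁ (b : D₁ × D₂).2‖ +
        ‖(b : D₁ × D₂)‖ * ‖π₂ (a : D₁ × D₂).1 - ρ₁ (a : D₁ × D₂).2‖ := by
  have h₁ := norm_mul_defect_le (π₂ := π₂) (ρ₁ := ρ₁) (a : D₁ × D₂) b
  have h₂ := norm_mul_defect_le (π₂ := π₂) (ρ₁ := ρ₁) (b : D₁ × D₂) a
  have e : π₂ (jordan a b : D₁ × D₂).1 - ρ₁ (jordan a b : D₁ × D₂).2 = (2 : ℂ)⁻¹ •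
      ((π₂ ((a : D₁ × D₂) * b).1 - ρ₁ ((a : D₁ × D₂) * b).2) +
        (π₂ ((b : D₁ × D₂) * a).1 - ρ₁ ((b : D₁ × D₂) * a).2)) := by
    simp only [jordan, Prod.smul_fst, Prod.smul_snd, Prod.fst_add, Prod.snd_add, map_smul, map_add]
    module
  have hc : ‖(2 : ℂ)⁻¹‖ = 1 / 2 := by simp
  rw [e, norm_smul, hc]
  linarith [norm_add_le (π₂ ((a : D₁ × D₂) * b).1 - ρ₁ ((a : D₁ × D₂) * b).2)
    (π₂ ((b : D₁ × D₂) * a).1 - ρ₁ ((b : D₁ × D₂) * a).2)]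

theorem norm_lie_defect_le (a b : selfAdjoint (D₁ × D₂)) :
    ‖π₂ (lie a b : D₁ × D₂).1 - ρ₁ (lie a b : D₁ × D₂).2‖ ≤
      ‖(a : D₁ × D₂)‖ * ‖π₂ (b : D₁ × D₂).1 - ρ₁ (b : D₁ × D₂).2‖ +
        ‖(b : D₁ × D₂)‖ * ‖π₂ (a : D₁ × D₂).1 - ρ₁ (a : D₁ × D₂).2‖ := by
  have h₁ := norm_mul_defect_le (π₂ := π₂) (ρ₁ := ρ₁) (a : D₁ × D₂) b
  have h₂ := norm_mul_defect_le (π₂ := π₂) (ρ₁ := ρ₁) (b : D₁ × D₂) a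
  have e : π₂ (lie a b : D₁ × D₂).1 - ρ₁ (lie a b : D₁ × D₂).2 = (2 * Complex.I)⁻¹ •
      ((π₂ ((a : D₁ × D₂) * b).1 - ρ₁ ((a : D₁ × D₂) * b).2) -
        (π₂ ((b : D₁ × D₂) * a).1 - ρ₁ ((b : D₁ × D₂) * a).2)) := by
    simp only [lie, Prod.smul_fst, Prod.smul_snd, Prod.fst_sub, Prod.snd_sub, map_smul, map_sub]
    module
  have hc : ‖(2 * Complex.I)⁻¹‖ = 1 / 2 := by simp
  rw [e, norm_smul, hc]
  linarith [norm_sub_le (π₂ ((a : D₁ × D₂) * b).1 - ρ₁ ((a : D₁ × D₂) * b).2)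
    (π₂ ((b : D₁ × D₂) * a).1 - ρ₁ ((b : D₁ × D₂) * a).2)]

theorem composedSeminorm_le_of_leibniz (hε : 0 < ε) {a b c : selfAdjoint (D₁ × D₂)}
    (hc₁ : L₁ (saMap (projFst D₁ D₂) c) ≤
      ‖(a : D₁ × D₂).1‖ₑ * L₁ (saMap (projFst D₁ D₂) b) +
        ‖(b : D₁ × D₂).1‖ₑ * L₁ (saMap (projFst D₁ D₂) a))
    (hc₂ : L₂ (saMap (projSnd D₁ D₂) c) ≤
      ‖(a : D₁ × D₂).2‖ₑ * L₂ (saMap (projSnd D₁ D₂) b) +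
        ‖(b : D₁ × D₂).2‖ₑ * L₂ (saMap (projSnd D₁ D₂) a))
    (hc : ‖π₂ (c : D₁ × D₂).1 - ρ₁ (c : D₁ × D₂).2‖ ≤
      ‖(a : D₁ × D₂)‖ * ‖π₂ (b : D₁ × D₂).1 - ρ₁ (b : D₁ × D₂).2‖ +
        ‖(b : D₁ × D₂)‖ * ‖π₂ (a : D₁ × D₂).1 - ρ₁ (a : D₁ × D₂).2‖) :
    composedSeminorm L₁ L₂ π₂ ρ₁ ε c ≤
      ‖(a : D₁ × D₂)‖ₑ * composedSeminorm L₁ L₂ π₂ ρ₁ ε b +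
        ‖(b : D₁ × D₂)‖ₑ * composedSeminorm L₁ L₂ π₂ ρ₁ ε a := by
  have n₁ : ∀ d : D₁ × D₂, ‖d.1‖ₑ ≤ ‖d‖ₑ := fun d => enorm_le_iff_norm_le.mpr (norm_fst_le d)
  have n₂ : ∀ d : D₁ × D₂, ‖d.2‖ₑ ≤ ‖d‖ₑ := fun d => enorm_le_iff_norm_le.mpr (norm_snd_le d)
  refine max_le (max_le (hc₁.trans ?_) (hc₂.trans ?_)) ?_
  · exact add_le_add (mul_le_mul' (n₁ _) (le_composedSeminorm_fst _))
      (mul_le_mul' (n₁ _) (le_composedSeminorm_fst _))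
  · exact add_le_add (mul_le_mul' (n₂ _) (le_composedSeminorm_snd _))
      (mul_le_mul' (n₂ _) (le_composedSeminorm_snd _))
  · refine le_trans ?_ (add_le_add (mul_le_mul_right (le_max_right _ _) _)
      (mul_le_mul_right (le_max_right _ _) _))
    rw [← ofReal_norm, ← ofReal_norm, ← ENNReal.ofReal_mul (norm_nonneg _),
      ← ENNReal.ofReal_mul (norm_nonneg _), ← ENNReal.ofReal_add (by positivity) (by positivity)]
    refine ENNReal.ofReal_le_ofReal
      ((mul_le_mul_of_nonneg_left hc (one_div_pos.mpr hε).le).trans_eq ?_)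
    ring

theorem composedSeminorm_add_le (hε : 0 < ε) (h₁ : ∀ a b, L₁ (a + b) ≤ L₁ a + L₁ b)
    (h₂ : ∀ a b, L₂ (a + b) ≤ L₂ a + L₂ b) (a b : selfAdjoint (D₁ × D₂)) :
    composedSeminorm L₁ L₂ π₂ ρ₁ ε (a + b) ≤
      composedSeminorm L₁ L₂ π₂ ρ₁ ε a + composedSeminorm L₁ L₂ π₂ ρ₁ ε b := by
  refine max_le (max_le ?_ ?_) ?_
  · exact (h₁ (saMap (projFst D₁ D₂) a) (saMap (projFst D₁ D₂) b)).trans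
      (add_le_add (le_composedSeminorm_fst _) (le_composedSeminorm_fst _))
  · exact (h₂ (saMap (projSnd D₁ D₂) a) (saMap (projSnd D₁ D₂) b)).trans
      (add_le_add (le_composedSeminorm_snd _) (le_composedSeminorm_snd _))
  · refine le_trans ?_ (add_le_add (le_max_right _ _) (le_max_right _ _))
    rw [← ENNReal.ofReal_add (by positivity) (by positivity), ← mul_add]
    refine ENNReal.ofReal_le_ofReal
      (mul_le_mul_of_nonneg_left (le_trans (le_of_eq ?_) (norm_add_le _ _)) (one_div_pos.mpr hε).le)
    rw [AddSubgroup.coe_add, Prod.fst_add, Prod.snd_add, map_add, map_add]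
    congr 1
    abel

theorem composedSeminorm_smul (h₁ : ∀ (r : ℝ) a, L₁ (r • a) = ‖r‖ₑ * L₁ a)
    (h₂ : ∀ (r : ℝ) a, L₂ (r • a) = ‖r‖ₑ * L₂ a) (r : ℝ) (a : selfAdjoint (D₁ × D₂)) :
    composedSeminorm L₁ L₂ π₂ ρ₁ ε (r • a) = ‖r‖ₑ * composedSeminorm L₁ L₂ π₂ ρ₁ ε a := by
  have hmono : Monotone fun x : ℝ≥0∞ => ‖r‖ₑ * x := fun _ _ h => mul_le_mul_right h _
  have e₁ : saMap (projFst D₁ D₂) (r • a) = r • saMap (projFst D₁ D₂) a := rfl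
  have e₂ : saMap (projSnd D₁ D₂) (r • a) = r • saMap (projSnd D₁ D₂) a := rfl
  rw [composedSeminorm, composedSeminorm, hmono.map_max, hmono.map_max, e₁, e₂, h₁, h₂]
  congr 1
  rw [selfAdjoint.val_smul, Prod.smul_fst, Prod.smul_snd, ← Complex.coe_smul r (a : D₁ × D₂).1,
    ← Complex.coe_smul r (a : D₁ × D₂).2, map_smul, map_smul, ← smul_sub, norm_smul,
    Complex.norm_real, ← ofReal_norm, ← ENNReal.ofReal_mul (norm_nonneg _)]
  congr 1
  ring

/-- The first two terms make the coordinates scalars `r` and `s`; the third forces `r = s`, since `1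
≠ 0` in `B`. -/
theorem composedSeminorm_eq_zero_iff [Nontrivial B] (hε : 0 < ε)
    (h₁ : ∀ a, L₁ a = 0 ↔ ∃ r : ℝ, a = r • (1 : selfAdjoint D₁))
    (h₂ : ∀ a, L₂ a = 0 ↔ ∃ r : ℝ, a = r • (1 : selfAdjoint D₂)) (a : selfAdjoint (D₁ × D₂)) :
    composedSeminorm L₁ L₂ π₂ ρ₁ ε a = 0 ↔ ∃ r : ℝ, a = r • (1 : selfAdjoint (D₁ × D₂)) := by
  have hs₁ : ∀ r : ℝ, π₂ (r • (1 : D₁)) = (r : ℂ) • 1 := fun r => by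
    rw [← Complex.coe_smul, map_smul, map_one]
  have hs₂ : ∀ r : ℝ, ρ₁ (r • (1 : D₂)) = (r : ℂ) • 1 := fun r => by
    rw [← Complex.coe_smul, map_smul, map_one]
  constructor
  · intro h
    obtain ⟨r, hr⟩ := (h₁ _).mp (le_antisymm ((le_composedSeminorm_fst a).trans_eq h) zero_le)
    obtain ⟨s, hs⟩ := (h₂ _).mp (le_antisymm ((le_composedSeminorm_snd a).trans_eq h) zero_le)
    have hr' : (a : D₁ × D₂).1 = r • (1 : D₁) := congrArg Subtype.val hr
    have hs' : (a : D₁ × D₂).2 = s • (1 : D₂) := congrArg Subtype.val hs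
    have h0 := le_antisymm ((le_max_right _ _).trans_eq h) zero_le
    rw [ENNReal.ofReal_eq_zero, hr', hs', hs₁, hs₂, ← sub_smul, norm_smul, norm_one, mul_one,
      one_div, inv_mul_le_iff₀ hε, mul_zero, norm_le_zero_iff, sub_eq_zero,
      Complex.ofReal_inj] at h0
    refine ⟨r, Subtype.ext (Prod.ext hr' ?_)⟩
    rw [hs', ← h0]
    rfl
  · rintro ⟨r, rfl⟩
    have e : π₂ ((r • (1 : selfAdjoint (D₁ × D₂)) : selfAdjoint (D₁ × D₂)) : D₁ × D₂).1 -
        ρ₁ ((r • (1 : selfAdjoint (D₁ × D₂)) : selfAdjoint (D₁ × D₂)) : D₁ × D₂).2 = 0 := by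
      change π₂ (r • (1 : D₁)) - ρ₁ (r • (1 : D₂)) = 0
      rw [hs₁, hs₂, sub_self]
    rw [composedSeminorm, e, (h₁ (saMap _ _)).mpr ⟨r, rfl⟩,
      (h₂ (saMap _ _)).mpr ⟨r, rfl⟩]
    simp

/-- The `ε` term is always finite, so the domain is the product of the two domains. -/
theorem dense_composedSeminorm_lt_top (h₁ : Dense {a | L₁ a < ∞}) (h₂ : Dense {a | L₂ a < ∞}) :
    Dense {d | composedSeminorm L₁ L₂ π₂ ρ₁ ε d < ∞} := by
  have hsurj : Function.Surjective
      fun p : selfAdjoint D₁ × selfAdjoint D₂ => saPair p.1 p.2 := fun d =>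
    ⟨(saMap (projFst D₁ D₂) d, saMap (projSnd D₁ D₂) d), rfl⟩
  have hcont : Continuous fun p : selfAdjoint D₁ × selfAdjoint D₂ => saPair p.1 p.2 :=
    ((continuous_subtype_val.comp continuous_fst).prodMk
      (continuous_subtype_val.comp continuous_snd)).subtype_mk _
  refine (hsurj.denseRange.dense_image hcont (h₁.prod h₂)).mono ?_
  rintro _ ⟨⟨a, b⟩, ⟨ha, hb⟩, rfl⟩
  exact max_lt (max_lt ha hb) ENNReal.ofReal_lt_top

theorem lowerSemicontinuous_composedSeminorm (h₁ : LowerSemicontinuous L₁)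
    (h₂ : LowerSemicontinuous L₂) :
    LowerSemicontinuous (composedSeminorm L₁ L₂ π₂ ρ₁ ε) := by
  have c₁ : Continuous (saMap (projFst D₁ D₂)) :=
    (continuous_fst.comp continuous_subtype_val).subtype_mk _
  have c₂ : Continuous (saMap (projSnd D₁ D₂)) :=
    (continuous_snd.comp continuous_subtype_val).subtype_mk _
  have hπ : Continuous π₂ := AddMonoidHomClass.continuous_of_bound π₂ 1 fun a => by
    simpa using NonUnitalStarAlgHom.norm_apply_le π₂ a
  have hρ : Continuous ρ₁ := AddMonoidHomClass.continuous_of_bound ρ₁ 1 fun a => by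
    simpa using NonUnitalStarAlgHom.norm_apply_le ρ₁ a
  refine ((h₁.comp c₁).sup (h₂.comp c₂)).sup (Continuous.lowerSemicontinuous ?_)
  exact ENNReal.continuous_ofReal.comp (continuous_const.mul
    ((hπ.comp (continuous_fst.comp continuous_subtype_val)).sub
      (hρ.comp (continuous_snd.comp continuous_subtype_val))).norm)

theorem isLeibnizQCMS_composedSeminorm [Nontrivial B] (h₁ : IsLeibnizQCMS D₁ L₁)
    (h₂ : IsLeibnizQCMS D₂ L₂) (hε : 0 < ε) :
    IsLeibnizQCMS (D₁ × D₂) (composedSeminorm L₁ L₂ π₂ ρ₁ ε) := by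
  -- Any state of `B` will do as the base point of the retractions.
  obtain ⟨μ⟩ := nonempty_stateSpace (A := B)
  have := h₁.nontrivial
  have hsmul := composedSeminorm_smul (π₂ := π₂) (ρ₁ := ρ₁) (ε := ε) h₁.smul_eq h₂.smul_eq
  have hdense := dense_composedSeminorm_lt_top (π₂ := π₂) (ρ₁ := ρ₁) (ε := ε)
    h₁.dense_domain h₂.dense_domain
  exact
    { nontrivial := inferInstance
      add_le := composedSeminorm_add_le hε h₁.add_le h₂.add_le
      smul_eq := hsmul
      dense_domain := hdense
      eq_zero_iff := composedSeminorm_eq_zero_iff hε h₁.eq_zero_iff h₂.eq_zero_iff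
      mkDist_ne_top := mkDist_composedSeminorm_ne_top h₁ h₂ hε μ
      metrizes := topology_eq_of_tendsto_mkDist hsmul hdense
        (tendsto_mkDist_composedSeminorm h₁ h₂ hε μ)
      leibniz_jordan := fun a b ha hb => composedSeminorm_le_of_leibniz hε
        (h₁.leibniz_jordan (saMap (projFst D₁ D₂) a) (saMap (projFst D₁ D₂) b)
          ((le_composedSeminorm_fst a).trans_lt ha) ((le_composedSeminorm_fst b).trans_lt hb))
        (h₂.leibniz_jordan (saMap (projSnd D₁ D₂) a) (saMap (projSnd D₁ D₂) b)
          ((le_composedSeminorm_snd a).trans_lt ha) ((le_composedSeminorm_snd b).trans_lt hb))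
        (norm_jordan_defect_le a b)
      leibniz_lie := fun a b ha hb => composedSeminorm_le_of_leibniz hε
        (h₁.leibniz_lie (saMap (projFst D₁ D₂) a) (saMap (projFst D₁ D₂) b)
          ((le_composedSeminorm_fst a).trans_lt ha) ((le_composedSeminorm_fst b).trans_lt hb))
        (h₂.leibniz_lie (saMap (projSnd D₁ D₂) a) (saMap (projSnd D₁ D₂) b)
          ((le_composedSeminorm_snd a).trans_lt ha) ((le_composedSeminorm_snd b).trans_lt hb))
        (norm_lie_defect_le a b)
      lowerSemicontinuous :=
        lowerSemicontinuous_composedSeminorm h₁.lowerSemicontinuous h₂.lowerSemicontinuous }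

/-! ### The composed tunnel and its extent -/

theorem isTunnel_composedSeminorm [Nontrivial B] (h₁ : IsTunnel LA LB L₁ π₁ π₂)
    (h₂ : IsTunnel LB LE L₂ ρ₁ ρ₂) (hε : 0 < ε) :
    IsTunnel LA LE (composedSeminorm L₁ L₂ π₂ ρ₁ ε) (π₁.comp (projFst D₁ D₂))
      (ρ₂.comp (projSnd D₁ D₂)) where
  isLeibnizQCMS := isLeibnizQCMS_composedSeminorm h₁.isLeibnizQCMS h₂.isLeibnizQCMS hε
  surjective_left := h₁.surjective_left.comp Prod.fst_surjective
  surjective_right := h₂.surjective_right.comp Prod.snd_surjective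
  quotient_left :=
    eq_iInf_comp h₁.quotient_left le_composedSeminorm_fst (exists_saMap_fst_eq h₁ h₂)
  quotient_right :=
    eq_iInf_comp h₂.quotient_right le_composedSeminorm_snd (exists_saMap_snd_eq h₁ h₂)

theorem extent_composedSeminorm_le [Nontrivial D₁] [Nontrivial D₂] (hε : 0 < ε) :
    extent (composedSeminorm L₁ L₂ π₂ ρ₁ ε) (π₁.comp (projFst D₁ D₂))
        (ρ₂.comp (projSnd D₁ D₂)) ≤
      extent L₁ π₁ π₂ + extent L₂ ρ₁ ρ₂ + ENNReal.ofReal ε := by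
  refine max_le ?_ ?_
  · refine (mkHausdorff_comp_le (π₂ := π₂) (ρ₁ := ρ₁) le_composedSeminorm_fst
      le_composedSeminorm_snd (fun μ => ?_) exists_eq_convexComb).trans
      (add_le_add_left (add_le_add (le_max_left _ _) (le_max_left _ _)) _)
    rw [mkDist_comm]
    exact mkDist_dualMap_comp_le hε μ
  -- The same estimate with the tunnels reversed; the convex decomposition is swapped accordingly.
  · refine (mkHausdorff_comp_le (π₂ := ρ₁) (ρ₁ := π₂) le_composedSeminorm_snd
      le_composedSeminorm_fst (mkDist_dualMap_comp_le hε) fun χ => ?_).trans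
      (add_le_add_left ?_ _)
    · obtain ⟨t, h0, h1, φ₁, φ₂, h⟩ := exists_eq_convexComb χ
      exact ⟨_, _, _, φ₂, φ₁, h.trans (convexComb_comm _ _ _ _ _)⟩
    · rw [add_comm (extent _ _ _)]
      exact add_le_add (le_max_right _ _) (le_max_right _ _)

end ComposedSeminorm

end QuantumMetric

theorem mainTheorem2 {A B E D₁ D₂ : Type*}
    [CStarAlgebra A] [CStarAlgebra B] [CStarAlgebra E] [CStarAlgebra D₁] [CStarAlgebra D₂]
    (LA : selfAdjoint A → ℝ≥0∞) (LB : selfAdjoint B → ℝ≥0∞) (LE : selfAdjoint E → ℝ≥0∞)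
    (hA : QuantumMetric.IsLeibnizQCMS A LA) (hB : QuantumMetric.IsLeibnizQCMS B LB)
    (hE : QuantumMetric.IsLeibnizQCMS E LE)
    (L₁ : selfAdjoint D₁ → ℝ≥0∞) (π₁ : D₁ →⋆ₐ[ℂ] A) (π₂ : D₁ →⋆ₐ[ℂ] B)
    (h₁ : QuantumMetric.IsTunnel LA LB L₁ π₁ π₂)
    (L₂ : selfAdjoint D₂ → ℝ≥0∞) (ρ₁ : D₂ →⋆ₐ[ℂ] B) (ρ₂ : D₂ →⋆ₐ[ℂ] E)
    (h₂ : QuantumMetric.IsTunnel LB LE L₂ ρ₁ ρ₂)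
    (ε : ℝ) (hε : 0 < ε) (L : selfAdjoint (D₁ × D₂) → ℝ≥0∞)
    (hL : L = QuantumMetric.composedSeminorm L₁ L₂ π₂ ρ₁ ε) :
    QuantumMetric.IsLeibnizQCMS (D₁ × D₂) L ∧
    QuantumMetric.IsTunnel LA LE L (π₁.comp (QuantumMetric.projFst D₁ D₂))
      (ρ₂.comp (QuantumMetric.projSnd D₁ D₂)) ∧
    (QuantumMetric.extent L₁ π₁ π₂ ≠ ∞ ∧ QuantumMetric.extent L₂ ρ₁ ρ₂ ≠ ∞ ∧
      QuantumMetric.extent L (π₁.comp (QuantumMetric.projFst D₁ D₂))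
          (ρ₂.comp (QuantumMetric.projSnd D₁ D₂)) ≤
        QuantumMetric.extent L₁ π₁ π₂ + QuantumMetric.extent L₂ ρ₁ ρ₂ + ENNReal.ofReal ε) ∧
    (QuantumMetric.IsAffineMap (QuantumMetric.dualMap (QuantumMetric.projFst D₁ D₂)) ∧
      ∀ φ ψ : QuantumMetric.stateSpace D₁,
        QuantumMetric.mkDist L (QuantumMetric.dualMap (QuantumMetric.projFst D₁ D₂) φ)
          (QuantumMetric.dualMap (QuantumMetric.projFst D₁ D₂) ψ) = QuantumMetric.mkDist L₁ φ ψ) ∧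
    (QuantumMetric.IsAffineMap (QuantumMetric.dualMap (QuantumMetric.projSnd D₁ D₂)) ∧
      ∀ φ ψ : QuantumMetric.stateSpace D₂,
        QuantumMetric.mkDist L (QuantumMetric.dualMap (QuantumMetric.projSnd D₁ D₂) φ)
          (QuantumMetric.dualMap (QuantumMetric.projSnd D₁ D₂) ψ) = QuantumMetric.mkDist L₂ φ ψ) := by
  subst hL
  have := hA.nontrivial
  have := hB.nontrivial
  have := hE.nontrivial
  have := h₁.isLeibnizQCMS.nontrivial
  have := h₂.isLeibnizQCMS.nontrivial
  have h₃ := QuantumMetric.isTunnel_composedSeminorm h₁ h₂ hε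
  exact ⟨h₃.isLeibnizQCMS, h₃,
    ⟨h₁.extent_ne_top, h₂.extent_ne_top, QuantumMetric.extent_composedSeminorm_le hε⟩,
    ⟨QuantumMetric.isAffineMap_dualMap _,
      QuantumMetric.mkDist_dualMap_eq h₃.isLeibnizQCMS QuantumMetric.le_composedSeminorm_fst
        (QuantumMetric.exists_saMap_fst_eq h₁ h₂)⟩,
    ⟨QuantumMetric.isAffineMap_dualMap _,
      QuantumMetric.mkDist_dualMap_eq h₃.isLeibnizQCMS QuantumMetric.le_composedSeminorm_snd
        (QuantumMetric.exists_saMap_snd_eq h₁ h₂)⟩⟩
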